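/- **Good graphs.** All graphs are finite and simple. A bowtie consists of two triangles sharing exactly one vertex; the chimney $C_n$ ($n\ge 2$) consists of $n$ triangles over one common edge. A graph $G=(V,E)$ is *good* if it contains no bowtie as a (not necessarily induced) subgraph and every vertex lies in a copy of some $C_n$, $n\ge2$, or of $K_4$. Let $E_0$ be the set of edges of $G$ lying in a triangle and $E_1=E\setminus E_0$. A vertex is *central* if it lies in at least two triangles; the *centre* $c(v)$ of a vertex $v$ is the set of central vertices in the component of $(V,E_0)$ containing $v$. It is either the common edge of a chimney or a copy of $K_4$. **Ordered good graphs.** An *ordered good graph* is a good graph with a linear order such that: every centre $c(v)$ is an interval; the vertices of centres of chimneys precede the vertices in copies of $K_4$; central vertices precede non-central ones; the non-central vertices with a given centre form an interval; and these intervals are ordered as their centres are. **Languages and lifts.** For distinct vertices $u,v$ of an ordered good graph $G$, let $t(u,v)$ be the isomorphism type of the structure that $(V,E_0,E_1,\le)$ induces on $\{u,v\}\cup c(u)\cup c(v)$, rooted in $(u,v)$. The language $L_2$ consists of unary symbols $L,R,1,2,3,4$, binary symbols $E_0,E_1,\le$, and a binary symbol $R^t$ for each type $t$ that occurs in this way.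 In the lift $L_2(G)$, the symbols $E_0,E_1,\le$ have their given meaning, $R^{t}$ holds for $(u,v)$ iff $u<v$ and $t=t(u,v)$, the relations $L$ and $R$ consist of the first and of the second vertices of centres of chimneys, and the relations $1,2,3,4$ of the first, second, third and fourth vertices of copies of $K_4$. The language $L^\bullet$ is $L_2$ without the symbols $R,2,3,4$, and the *reduction* $L_2(G)^\bullet$ is the $L^\bullet$-structure that $L_2(G)$ induces on the vertices in none of $R,2,3,4$. **The class.** An $L^\bullet$-structure is *complete* if any two distinct vertices lie together in a tuple of some relation other than $\le$. Let $\mathcal T$ be the set of all complete $L^\bullet$-structures on at most three vertices that do not embed (as induced substructures) into $L_2(G)^\bullet$ for any ordered good graph $G$. An $L^\bullet$-structure is *admissibly ordered* if $\le$ is a linear order in which the vertices in $L$ precede those in $1$, and the vertices in $L$ or $1$ precede the vertices in neither. Let $\mathrm{Forb}_{L^\bullet}(\mathcal T)$ be the class of all finite admissibly ordered $L^\bullet$-structures that contain no structure from $\mathcal T$ as an induced substructure; its members need not be complete. **Theorem.** $\mathrm{Forb}_{L^\bullet}(\mathcal T)$ is a Ramsey class: for all $\mathbf A,\mathbf B\in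 \mathrm{Forb}_{L^\bullet}(\mathcal T)$ and every integer $k\ge 1$ there is $\mathbf C\in\mathrm{Forb}_{L^\bullet}(\mathcal T)$ with $\mathbf C\to(\mathbf B)^{\mathbf A}_k$, that is, for every colouring with $k$ colours of the induced substructures of $\mathbf C$ isomorphic to $\mathbf A$ there is an induced substructure $\widetilde{\mathbf B}$ of $\mathbf C$ isomorphic to $\mathbf B$ such that all substructures of $\widetilde{\mathbf B}$ isomorphic to $\mathbf A$ have the same colour. In particular, there is such a $\mathbf C$ with $\mathbf C\to(\mathbf B)^{\mathbf A}_2$. -/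

import Mathlib

open FirstOrder

namespace BowtieFree

/-! ### Good bowtie-free graphs and their centres -/

section Graph

variable {V : Type}

/-- The bowtie: two triangles `0 1 2` and `0 3 4` sharing the single vertex `0`. -/
def bowtie : SimpleGraph (Fin 5) :=
  SimpleGraph.fromEdgeSet {s(0, 1), s(0, 2), s(1, 2), s(0, 3), s(0, 4), s(3, 4)}

/-- The chimney graph with `n` triangles over one common edge: the common edge joins the two
vertices on the left, and each of the `n` vertices on the right is joined to both of them. -/
def chimney (n : ℕ) : SimpleGraph (Fin 2 ⊕ Fin n) :=
  SimpleGraph.fromRel fun x _ => x.isLeft = true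

/-- The vertex `v` of `G` lies in a copy of `H`, i.e. in a not necessarily induced subgraph of `G`
isomorphic to `H`. -/
def InCopy {W : Type} (H : SimpleGraph W) (G : SimpleGraph V) (v : V) : Prop :=
  ∃ f : SimpleGraph.Copy H G, v ∈ Set.range f

/-- Good graphs: no bowtie as a not necessarily induced subgraph, and every vertex lies in a copy
of a chimney (with at least two triangles) or of the complete graph on four vertices. -/
def IsGood (G : SimpleGraph V) : Prop :=
  bowtie.Free G ∧
    ∀ v, (∃ n, 2 ≤ n ∧ InCopy (chimney n) G v) ∨ InCopy (⊤ : SimpleGraph (Fin 4)) G v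

/-- Edges of type 0: the edges that lie in a triangle. They form the graph `(V, E₀)`. -/
def edgeZero (G : SimpleGraph V) : SimpleGraph V where
  Adj u v := G.Adj u v ∧ ∃ w, G.Adj u w ∧ G.Adj v w
  symm := ⟨fun _ _ ⟨h, w, h₁, h₂⟩ => ⟨h.symm, w, h₂, h₁⟩⟩
  loopless := ⟨fun _ h => h.1.ne rfl⟩

/-- Edges of type 1: all the remaining edges. -/
def edgeOne (G : SimpleGraph V) : SimpleGraph V := G \ edgeZero G

/-- Central vertices: those contained in two or more triangles. -/
def IsCentral (G : SimpleGraph V) (v : V) : Prop :=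
  ∃ s t : Finset V, s ≠ t ∧ G.IsNClique 3 s ∧ G.IsNClique 3 t ∧ v ∈ s ∧ v ∈ t

/-- The centre `c(v)` of a vertex: the central vertices in its connected component in `(V, E₀)`. -/
def centre (G : SimpleGraph V) (v : V) : Set V :=
  {w | IsCentral G w ∧ (edgeZero G).Reachable v w}

/-- Admissible orderings of a good graph. -/
structure IsAdmissible [LinearOrder V] (G : SimpleGraph V) : Prop where
  /-- every vertex centre is an interval -/
  interval : ∀ v, (centre G v).OrdConnected
  /-- centres of chimneys come before vertices in copies of `K₄` -/
  chimney_before_k4 : ∀ u v, IsCentral G u → ¬ InCopy (⊤ : SimpleGraph (Fin 4)) G u →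
    InCopy (⊤ : SimpleGraph (Fin 4)) G v → u < v
  /-- central vertices come before non-central ones -/
  central_before : ∀ u v, IsCentral G u → ¬ IsCentral G v → u < v
  /-- the non-central vertices with a given centre form an interval -/
  fibre_interval : ∀ u v w, ¬ IsCentral G u → ¬ IsCentral G w → centre G u = centre G w →
    u ≤ v → v ≤ w → centre G v = centre G u
  /-- the order of these intervals follows the order of the centres -/
  fibre_order : ∀ u v, ¬ IsCentral G u → ¬ IsCentral G v →
    (∀ a ∈ centre G u, ∀ b ∈ centre G v, a < b) → u < v

end Graph

/-- Finite good graphs with an admissible linear ordering. -/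
structure OrderedGoodGraph where
  V : Type
  finite : Finite V
  order : LinearOrder V
  graph : SimpleGraph V
  good : IsGood graph
  admissible : IsAdmissible graph

attribute [instance] OrderedGoodGraph.finite OrderedGoodGraph.order

namespace OrderedGoodGraph

variable (G : OrderedGoodGraph)

/-- The first vertex of the centre of a chimney (relation `L`). -/
def IsLeft (u : G.V) : Prop := ∃ v, u < v ∧ centre G.graph u = {u, v}

/-- The second vertex of the centre of a chimney (relation `R`). -/
def IsRight (v : G.V) : Prop := ∃ u, u < v ∧ centre G.graph v = {u, v}

/-- The vertex `v` is the vertex number `i` (in increasing order, from `0` to `3`) of a copy of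
`K₄`. -/
def IsK4Vertex (i : Fin 4) (v : G.V) : Prop :=
  ∃ f : Fin 4 → G.V, StrictMono f ∧ (∀ j k, j ≠ k → G.graph.Adj (f j) (f k)) ∧ f i = v

/-- The set `{u, v} ∪ c(u) ∪ c(v)`. -/
def pairSpan (u v : G.V) : Set G.V := {u, v} ∪ centre G.graph u ∪ centre G.graph v

end OrderedGoodGraph

/-- A finite ordered structure with two binary relations and two roots. It lives on `Fin size` with
its natural order; every isomorphism class of such structures has exactly one representative of
this form. -/
structure RootedStr where
  size : ℕ
  zero : Fin size → Fin size → Prop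
  one : Fin size → Fin size → Prop
  root₁ : Fin size
  root₂ : Fin size

/-- `t` is the isomorphism type `t(u, v)` of the ordered structure (with edges of type 0 and 1)
that `G` induces on `{u, v} ∪ c(u) ∪ c(v)`, rooted in `(u, v)`. -/
def HasType (G : OrderedGoodGraph) (u v : G.V) (t : RootedStr) : Prop :=
  ∃ f : Fin t.size ≃o G.pairSpan u v,
    (∀ i j, t.zero i j ↔ (edgeZero G.graph).Adj (f i) (f j)) ∧
    (∀ i j, t.one i j ↔ (edgeOne G.graph).Adj (f i) (f j)) ∧
    (f t.root₁ : G.V) = u ∧ (f t.root₂ : G.V) = v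

/-- The isomorphism types `t(u, v)` that occur in ordered good graphs. -/
def PairType : Type :=
  {t : RootedStr // ∃ (G : OrderedGoodGraph) (u v : G.V), u ≠ v ∧ HasType G u v t}

/-! ### The lift of an ordered good graph and its reduction -/

/-- Relation symbols of the language `L₂`. -/
inductive LiftRel : ℕ → Type
  | left : LiftRel 1
  | right : LiftRel 1
  | k4 (i : Fin 4) : LiftRel 1
  | le : LiftRel 2
  | edge₀ : LiftRel 2
  | edge₁ : LiftRel 2
  | typ (t : PairType) : LiftRel 2

/-- The language `L₂`. -/
def liftLang : Language := ⟨fun _ => Empty, LiftRel⟩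

/-- The lift `L₂(G)` of an ordered good graph `G`. -/
instance liftStr (G : OrderedGoodGraph) : liftLang.Structure G.V where
  funMap := fun f => Empty.elim f
  RelMap := fun {_} r => match r with
    | LiftRel.left => fun x => G.IsLeft (x 0)
    | LiftRel.right => fun x => G.IsRight (x 0)
    | LiftRel.k4 i => fun x => G.IsK4Vertex i (x 0)
    | LiftRel.le => fun x => x 0 ≤ x 1
    | LiftRel.edge₀ => fun x => (edgeZero G.graph).Adj (x 0) (x 1)
    | LiftRel.edge₁ => fun x => (edgeOne G.graph).Adj (x 0) (x 1)
    | LiftRel.typ t => fun x => x 0 < x 1 ∧ HasType G (x 0) (x 1) t.1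

/-- Relation symbols of the language `L•`: those of `L₂` without the unary relations `R`, `2`, `3`,
`4`, whose vertices are removed in reductions. -/
inductive RedRel : ℕ → Type
  | left : RedRel 1
  | first : RedRel 1
  | le : RedRel 2
  | edge₀ : RedRel 2
  | edge₁ : RedRel 2
  | typ (t : PairType) : RedRel 2

/-- The language `L•`. -/
def redLang : Language := ⟨fun _ => Empty, RedRel⟩

/-- The symbols of `L•` as symbols of `L₂`. -/
def RedRel.toLift : {n : ℕ} → RedRel n → LiftRel n
  | _, .left => .left
  | _, .first => .k4 0
  | _, .le => .le
  | _, .edge₀ => .edge₀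
  | _, .edge₁ => .edge₁
  | _, .typ t => .typ t

/-- The vertices that stay in the reduction: those not in the relations `R`, `2`, `3`, `4`. -/
def Kept (G : OrderedGoodGraph) : Type :=
  {v : G.V // ¬ G.IsRight v ∧ ∀ i : Fin 4, i ≠ 0 → ¬ G.IsK4Vertex i v}

/-- The reduction `L₂(G)•`: what `L₂(G)` induces on the vertices that are kept, as an
`L•`-structure. -/
instance reductionStr (G : OrderedGoodGraph) : redLang.Structure (Kept G) where
  funMap := fun f => Empty.elim f
  RelMap := fun {n} r x =>
    Language.Structure.RelMap (L := liftLang) (M := G.V) (n := n) (RedRel.toLift r)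
      (fun i => (x i).1)

/-! ### Classes of `L•`-structures -/

/-- `L•`-structures (with a vertex set in `Type`). -/
abbrev RedStr : Type 1 := CategoryTheory.Bundled.{0} redLang.Structure

/-- The vertex `x` is in the relation `L`. -/
def InLeft (A : RedStr) (x : A) : Prop :=
  Language.Structure.RelMap (L := redLang) (n := 1) RedRel.left ![x]

/-- The vertex `x` is in the relation `1`. -/
def InFirst (A : RedStr) (x : A) : Prop :=
  Language.Structure.RelMap (L := redLang) (n := 1) RedRel.first ![x]

/-- The pair `(x, y)` is in the binary relation `r`. -/
def BinRel (A : RedStr) (r : RedRel 2) (x y : A) : Prop :=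
  Language.Structure.RelMap (L := redLang) (n := 2) r ![x, y]

/-- The relation `≤` of `A` is a linear order. -/
structure IsOrdered (A : RedStr) : Prop where
  refl : ∀ x : A, BinRel A .le x x
  antisymm : ∀ x y : A, BinRel A .le x y → BinRel A .le y x → x = y
  trans : ∀ x y z : A, BinRel A .le x y → BinRel A .le y z → BinRel A .le x z
  total : ∀ x y : A, BinRel A .le x y ∨ BinRel A .le y x

/-- The strict order of `A`. -/
def Before (A : RedStr) (x y : A) : Prop := BinRel A .le x y ∧ x ≠ y

/-- Admissible orderings of `L•`-structures: vertices in `L`, then vertices in `1`, then the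
vertices in neither (the non-central ones). -/
structure IsAdmissiblyOrdered (A : RedStr) : Prop where
  ordered : IsOrdered A
  left_first : ∀ x y : A, InLeft A x → InFirst A y → Before A x y
  left_rest : ∀ x y : A, InLeft A x → ¬ InLeft A y → ¬ InFirst A y → Before A x y
  first_rest : ∀ x y : A, InFirst A x → ¬ InLeft A y → ¬ InFirst A y → Before A x y

/-- Complete structures: any two distinct vertices are together in a tuple of some relation other
than the order. -/
def IsComplete (A : RedStr) : Prop :=
  ∀ x y : A, x ≠ y → ∃ r : RedRel 2, r ≠ .le ∧ (BinRel A r x y ∨ BinRel A r y x)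

/-- `A` is (isomorphic to) an induced substructure of the reduction of the lift of an ordered good
graph. -/
def IsReducedLift (A : RedStr) : Prop :=
  ∃ G : OrderedGoodGraph, Nonempty (A ↪[redLang] Kept G)

/-- The set `𝒯` of the complete `L•`-structures on at most three vertices that are not substructures
of a reduced lift. -/
def triangles : Set RedStr :=
  {F | Finite F ∧ Nat.card F ≤ 3 ∧ IsComplete F ∧ ¬ IsReducedLift F}

/-- `A` contains no structure from `S` as an induced substructure. -/
def Avoids (S : Set RedStr) (A : RedStr) : Prop :=
  ∀ F ∈ S, IsEmpty (F ↪[redLang] A)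

/-- The class `Forb_{L•}(S)`: finite, admissibly ordered structures that contain no structure
from `S` as an induced substructure. -/
def forb (S : Set RedStr) : Set RedStr :=
  {A | Finite A ∧ IsAdmissiblyOrdered A ∧ Avoids S A}

/-- The class `Forb_{L•}(S)` is the same for every set `S` of complete structures on at most three
vertices such that the complete ordered structures avoiding `S` are exactly the substructures of
reduced lifts. -/
theorem forb_eq_forb_triangles (S : Set RedStr)
    (hS : ∀ F ∈ S, Finite F ∧ Nat.card F ≤ 3 ∧ IsComplete F)
    (hdesc : ∀ A : RedStr, Finite A → IsOrdered A → IsComplete A → (Avoids S A ↔ IsReducedLift A)) :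
    forb S = forb triangles := by
  have key : ∀ {F A : RedStr} (f : F ↪[redLang] A), IsOrdered A → IsOrdered F := by
    intro F A f h
    have hr : ∀ x y : F, BinRel F .le x y ↔ BinRel A .le (f x) (f y) := by
      intro x y
      have := f.map_rel (n := 2) RedRel.le ![x, y]
      rw [BinRel, BinRel, ← this]
      congr!
      ext i
      fin_cases i <;> rfl
    refine ⟨fun x => (hr _ _).2 (h.refl _), fun x y h₁ h₂ => ?_, fun x y z h₁ h₂ => ?_,
      fun x y => ?_⟩
    · exact f.injective (h.antisymm _ _ ((hr _ _).1 h₁) ((hr _ _).1 h₂))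
    · exact (hr _ _).2 (h.trans _ _ _ ((hr _ _).1 h₁) ((hr _ _).1 h₂))
    · simpa only [hr] using h.total (f x) (f y)
  ext A
  refine and_congr_right fun _ => and_congr_right fun hA => ⟨fun h F hF => ⟨fun f => ?_⟩,
    fun h F hF => ⟨fun f => ?_⟩⟩
  · obtain ⟨hfin, -, hc, hn⟩ := hF
    refine hn ((hdesc F hfin (key f hA.ordered) hc).1 fun F' hF' => ⟨fun g => ?_⟩)
    exact (h F' hF').false (f.comp g)
  · obtain ⟨hfin, h3, hc⟩ := hS F hF
    refine (h F ⟨hfin, h3, hc, fun hr => ?_⟩).false f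
    exact ((hdesc F hfin (key f hA.ordered) hc).2 hr F hF).false
      (Language.Embedding.refl redLang F)

/-! ### Ramsey classes -/

/-- `C ⟶ (B)^A_k`: for every colouring with `k` colours of the substructures of `C` isomorphic to
`A` there is a substructure of `C` isomorphic to `B` all of whose substructures isomorphic to `A`
have the same colour. -/
def Arrows (C B A : RedStr) (k : ℕ) : Prop :=
  ∀ χ : {A' : redLang.Substructure C // Nonempty (A ≃[redLang] A')} → Fin k,
    ∃ B' : redLang.Substructure C, Nonempty (B ≃[redLang] B') ∧
      ∃ c : Fin k, ∀ A', A'.1 ≤ B' → χ A' = c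

/-- Ramsey classes. -/
def IsRamseyClass (K : Set RedStr) : Prop :=
  ∀ A ∈ K, ∀ B ∈ K, ∀ k : ℕ, 1 ≤ k → ∃ C ∈ K, Arrows C B A k

end BowtieFree

/-!
The proof is the partite construction of Nešetřil and Rödl. A structure is encoded as an ordered
vertex set together with a label for every pair of vertices that is in a common relation; the label
of `(v, v)` records the unary relations of `v`. An embedding is then a strictly increasing map that
preserves labels.

Ramsey's theorem gives an arrow for increasing maps from `A` to `B`. One handles one by one the
increasing maps from `A` to the large linear order: a power of the current partite system, given by
the Hales–Jewett theorem, makes the colour constant on the copies of `A` above one of them. The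
first round starts from copies of `B` above all increasing maps, and yields a structure with an
arrow but with uncontrolled cliques. The second round starts from disjoint copies of `B` above the
embeddings of `B` in the structure found in the first one. As powers create no new cliques, every
clique then lies above one copy of `B`. A complete forbidden structure is a clique, hence it would
embed in `B`. Labels determine the block (`L`, then `1`, then the rest) of a vertex, so the
resulting structure can be ordered by blocks first.
-/

namespace BowtieFree

section Ramsey

universe u v

variable {α : Type u} {κ : Type v}

/-- The colouring `χ` gives all `m`-element subsets of `Y` the same colour. -/
def IsHomogeneous (χ : Finset α → κ) (m : ℕ) (Y : Finset α) : Prop :=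
  ∃ c, ∀ s ⊆ Y, s.card = m → χ s = c

section LinearOrder

variable [LinearOrder α]

/-- The colouring `χ` gives an `(m + 1)`-element subset of `Y` a colour that depends only on its
least element. -/
def IsMinHomogeneous (χ : Finset α → κ) (m : ℕ) (Y : Finset α) : Prop :=
  ∃ f : α → κ, ∀ s ⊆ Y, s.card = m + 1 → ∀ hs : s.Nonempty, χ s = f (s.min' hs)

theorem IsMinHomogeneous.insert_min {χ : Finset α → κ} {m : ℕ} {Y : Finset α} {x : α}
    (hY : IsMinHomogeneous χ m Y) (hlt : ∀ y ∈ Y, x < y)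
    (hx : IsHomogeneous (fun s => χ (insert x s)) m Y) : IsMinHomogeneous χ m (insert x Y) := by
  obtain ⟨f, hf⟩ := hY
  obtain ⟨c, hc⟩ := hx
  refine ⟨fun y => if y = x then c else f y, fun s hs hcard hne => ?_⟩
  by_cases hxs : x ∈ s
  · have hmin : s.min' hne = x := by
      refine (s.min'_le x hxs).antisymm (s.le_min' hne x fun y hy => ?_)
      rcases Finset.mem_insert.1 (hs hy) with rfl | hyY
      exacts [le_rfl, (hlt y hyY).le]
    have hcolour := hc (s.erase x) (Finset.subset_insert_iff.1 hs)
      (by rw [Finset.card_erase_of_mem hxs, hcard, Nat.add_sub_cancel])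
    simpa only [Finset.insert_erase hxs, hmin, if_true] using hcolour
  · have hmin : s.min' hne ≠ x := fun h => hxs (h ▸ s.min'_mem hne)
    exact (hf s ((Finset.subset_insert_iff_of_notMem hxs).1 hs) hcard hne).trans
      (if_neg hmin).symm

theorem IsMinHomogeneous.exists_isHomogeneous [Finite κ] {χ : Finset α → κ} {m l : ℕ}
    {Y : Finset α} (hY : IsMinHomogeneous χ m Y) (hcard : Nat.card κ * l ≤ Y.card) :
    ∃ Z ⊆ Y, Z.card = l ∧ IsHomogeneous χ (m + 1) Z := by
  classical
  have := Fintype.ofFinite κ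
  obtain ⟨f, hf⟩ := hY
  obtain ⟨c, -, hc⟩ := Finset.exists_le_card_fiber_of_mul_le_card_of_maps_to (t := Finset.univ)
    (fun x _ => Finset.mem_univ (f x)) ⟨χ ∅, Finset.mem_univ _⟩
    (by rwa [Finset.card_univ, ← Nat.card_eq_fintype_card])
  obtain ⟨Z, hZ, hZl⟩ := Finset.exists_subset_card_eq hc
  have hZY : Z ⊆ Y := hZ.trans (Finset.filter_subset _ _)
  refine ⟨Z, hZY, hZl, c, fun s hs hsm => ?_⟩
  have hne : s.Nonempty := Finset.card_pos.1 (hsm ▸ m.succ_pos)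
  rw [hf s (hs.trans hZY) hsm hne]
  exact (Finset.mem_filter.1 (hZ (hs (s.min'_mem hne)))).2

theorem exists_isMinHomogeneous {m : ℕ}
    (hm : ∀ l : ℕ, ∃ n : ℕ, ∀ X : Finset α, n ≤ X.card → ∀ χ : Finset α → κ,
      ∃ Y ⊆ X, Y.card = l ∧ IsHomogeneous χ m Y) (l : ℕ) :
    ∃ n : ℕ, ∀ X : Finset α, n ≤ X.card → ∀ χ : Finset α → κ,
      ∃ Y ⊆ X, Y.card = l ∧ IsMinHomogeneous χ m Y := by
  induction l with
  | zero =>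
    refine ⟨0, fun X _ χ => ⟨∅, X.empty_subset, rfl, fun _ => χ ∅, fun s hs _ hne => ?_⟩⟩
    exact absurd (Finset.subset_empty.1 hs) hne.ne_empty
  | succ l ih =>
    obtain ⟨n, hn⟩ := ih
    obtain ⟨N, hN⟩ := hm n
    refine ⟨N + 1, fun X hX χ => ?_⟩
    have hne : X.Nonempty := Finset.card_pos.1 (N.succ_pos.trans_le hX)
    set x := X.min' hne
    obtain ⟨H, hHX, hHn, c, hc⟩ := hN (X.erase x)
      (by rw [Finset.card_erase_of_mem (X.min'_mem hne)]; omega) (fun s => χ (insert x s))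
    obtain ⟨Y, hYH, hYl, hY⟩ := hn H hHn.ge χ
    have hlt : ∀ y ∈ Y, x < y := fun y hy =>
      Finset.min'_lt_of_mem_erase_min' X hne (hHX (hYH hy))
    refine ⟨insert x Y, ?_, ?_, hY.insert_min hlt ⟨c, fun s hs => hc s (hs.trans hYH)⟩⟩
    · exact Finset.insert_subset (X.min'_mem hne) ((hYH.trans hHX).trans (X.erase_subset x))
    · rw [Finset.card_insert_of_notMem fun h => (hlt x h).false, hYl]

end LinearOrder

theorem exists_isHomogeneous [Finite κ] (m l : ℕ) :
    ∃ n : ℕ, ∀ X : Finset α, n ≤ X.card → ∀ χ : Finset α → κ,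
      ∃ Y ⊆ X, Y.card = l ∧ IsHomogeneous χ m Y := by
  classical
  let _ : LinearOrder α := linearOrderOfSTO WellOrderingRel
  induction m generalizing l with
  | zero =>
    refine ⟨l, fun X hX χ => ?_⟩
    obtain ⟨Y, hYX, hYl⟩ := Finset.exists_subset_card_eq hX
    exact ⟨Y, hYX, hYl, χ ∅, fun s _ hs => by rw [Finset.card_eq_zero.1 hs]⟩
  | succ m ih =>
    obtain ⟨n, hn⟩ := exists_isMinHomogeneous ih (Nat.card κ * l)
    refine ⟨n, fun X hX χ => ?_⟩
    obtain ⟨Y, hYX, hYcard, hY⟩ := hn X hX χ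
    obtain ⟨Z, hZY, hZ⟩ := hY.exists_isHomogeneous hYcard.ge
    exact ⟨Z, hZY.trans hYX, hZ⟩

end Ramsey

section MapArrow

universe u v w x

/-- The arrow `V ⟶ (B)^A` for maps: for every colouring of the maps `A → V` by `κ` there is a map
`f : B → V` in `F` such that all maps `f ∘ e` with `e ∈ E` have the same colour. Here `E` and `F`
play the role of the embeddings of `A` in `B` and of `B` in `V`. -/
def MapArrow {A : Type u} {B : Type v} {V : Type w} (κ : Type x) (E : Set (A → B))
    (F : Set (B → V)) : Prop :=
  ∀ χ : (A → V) → κ, ∃ f ∈ F, ∃ c, ∀ e ∈ E, χ (f ∘ e) = c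

variable {A : Type u} {B : Type v} {V : Type w} {κ : Type x}

theorem MapArrow.mono {E E' : Set (A → B)} {F F' : Set (B → V)} (h : MapArrow κ E F)
    (hE : E' ⊆ E) (hF : F ⊆ F') : MapArrow κ E' F' := by
  intro χ
  obtain ⟨f, hf, c, hc⟩ := h χ
  exact ⟨f, hF hf, c, fun e he => hc e (hE he)⟩

theorem exists_mapArrow_strictMono (κ : Type x) [Finite κ] [Nonempty κ] (A : Type u) (B : Type v)
    [Finite A] [Finite B] [LinearOrder A] [LinearOrder B] :
    ∃ n : ℕ, MapArrow κ {e : A → B | StrictMono e} {b : B → Fin n | StrictMono b} := by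
  classical
  have := Fintype.ofFinite A
  have := Fintype.ofFinite B
  obtain ⟨n, hn⟩ := exists_isHomogeneous (α := ℕ) (κ := κ) (Fintype.card A) (Fintype.card B)
  refine ⟨n, fun χ => ?_⟩
  let image : {a : A → Fin n // StrictMono a} → Finset ℕ := fun a =>
    Finset.univ.image fun x => (a.1 x : ℕ)
  have image_injective : Function.Injective image := by
    intro a a' h
    refine Subtype.ext ((a.2.range_inj a'.2).1 (Set.ext fun z => ?_))
    simpa [image, Fin.val_inj] using Finset.ext_iff.1 h z
  obtain ⟨Y, hYn, hYB, c, hc⟩ := hn (Finset.range n) (Finset.card_range n).ge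
    (Function.extend image (fun a => χ a.1) fun _ => Classical.arbitrary κ)
  let i : B ≃o Y := (Fintype.orderIsoFinOfCardEq B rfl).symm.trans (Y.orderIsoOfFin hYB)
  let b : B → Fin n := fun x => ⟨i x, Finset.mem_range.1 (hYn (i x).2)⟩
  have hb : StrictMono b := fun x y h => i.strictMono h
  refine ⟨b, hb, c, fun e he => ?_⟩
  let a : {a : A → Fin n // StrictMono a} := ⟨b ∘ e, hb.comp he⟩
  rw [← hc (image a) ?_ ?_, image_injective.extend_apply]
  · exact Finset.image_subset_iff.2 fun x _ => (i (e x)).2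
  · exact Finset.card_image_of_injective _ (Fin.val_injective.comp a.2.injective)

end MapArrow

section Labels

universe u v w

variable {U : Type u} {V : Type v} {T : Type w}

/-- A labelling of the ordered pairs of elements of `V` is a map `ρ : V → V → Option T`; pairs with
`ρ x y = none` are unlabelled. A map preserves labels if it maps every pair to a pair with the same
label, and every unlabelled pair to an unlabelled pair. -/
def PreservesLabels (ρU : U → U → Option T) (ρV : V → V → Option T) (f : U → V) : Prop :=
  ∀ x y, ρV (f x) (f y) = ρU x y

/-- All pairs of elements of `S`, including the pairs `(x, x)`, are labelled. -/
def IsClique (ρ : V → V → Option T) (S : Set V) : Prop :=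
  ∀ x ∈ S, ∀ y ∈ S, ρ x y ≠ none

/-- The embeddings of one ordered labelled set in another one. -/
def labelledEmbeddings [Preorder U] [Preorder V] (ρU : U → U → Option T)
    (ρV : V → V → Option T) : Set (U → V) :=
  {f | StrictMono f ∧ PreservesLabels ρU ρV f}

end Labels

/-- A finite set `V` with a labelling of its pairs, partitioned by `proj` into parts that are
indexed by `N`. -/
structure PartiteSystem.{u, v, w} (N : Type v) (T : Type w) where
  V : Type u
  finite : Finite V
  proj : V → N
  label : V → V → Option T

attribute [instance] PartiteSystem.finite

namespace PartiteSystem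

universe u u' v w x y

variable {N : Type v} {T : Type w}

/-- The map `f` preserves labels and parts. -/
structure IsEmbedding (D : PartiteSystem.{u} N T) (D' : PartiteSystem.{u'} N T) (f : D.V → D'.V) :
    Prop where
  proj : ∀ x, D'.proj (f x) = D.proj x
  label : PreservesLabels D.label D'.label f

theorem IsEmbedding.id (D : PartiteSystem.{u} N T) : D.IsEmbedding D _root_.id :=
  ⟨fun _ => rfl, fun _ _ => rfl⟩

theorem IsEmbedding.comp {D : PartiteSystem.{u} N T} {D' : PartiteSystem.{u'} N T}
    {D'' : PartiteSystem.{x} N T} {g : D'.V → D''.V} {f : D.V → D'.V} (hg : D'.IsEmbedding D'' g)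
    (hf : D.IsEmbedding D' f) : D.IsEmbedding D'' (g ∘ f) :=
  ⟨fun x => (hg.proj _).trans (hf.proj x), fun x y => (hg.label _ _).trans (hf.label x y)⟩

open Classical in
/-- A value of `w` that differs from `t` if there is one, and `t` otherwise. It labels a pair of
tuples of a power of a system: along a combinatorial line, the labels in the fixed coordinates are a
known value `t`, and those in the variable coordinates are all equal. -/
noncomputable def select {ι : Type u} {T : Type v} (t : T) (w : ι → T) : T :=
  if h : ∃ j, w j ≠ t then w h.choose else t

theorem select_eq {ι : Type u} {T : Type v} {t s : T} {w : ι → T} (hw : ∀ j, w j = t ∨ w j = s)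
    (hs : ∃ j, w j = s) : select t w = s := by
  unfold select
  split_ifs with h
  · exact (hw _).resolve_left h.choose_spec
  · push Not at h
    obtain ⟨j, hj⟩ := hs
    rw [← hj, h j]

section Power

variable (D : PartiteSystem.{u} N T) {s : Set N} (R : s → s → Option T)

/-- The copies in `D` of the labelled set `s` that have one vertex in each part over `s`. -/
abbrev Transversal : Type (max u v) :=
  {σ : s → D.V // (∀ n, D.proj (σ n) = n) ∧ PreservesLabels R D.label σ}

variable (ι : Type y)

/-- The vertices of the power of `D` over `s`: all `ι`-tuples of vertices in the same part over
`s`, and, for every combinatorial line of transversals, a copy of the vertices of `D` that are not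
over `s`. -/
abbrev PowerVertex : Type (max u v y) :=
  {p : s × (ι → D.V) // ∀ j, D.proj (p.2 j) = p.1} ⊕
    Combinatorics.Line (D.Transversal R) ι × {v : D.V // D.proj v ∉ s}

variable {D R ι}

open Classical in
/-- The copy of `D` in its power that belongs to a combinatorial line. -/
noncomputable def lineMap (l : Combinatorics.Line (D.Transversal R) ι) (v : D.V) :
    D.PowerVertex R ι :=
  if h : D.proj v ∈ s then
    .inl ⟨(⟨D.proj v, h⟩, fun j => (l.idxFun j).elim v fun σ => σ.1 ⟨D.proj v, h⟩), fun j => by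
      cases hj : l.idxFun j with
      | none => simp only [hj, Option.elim_none]
      | some σ => simpa only [hj, Option.elim_some] using σ.2.1 _⟩
  else .inr (l, ⟨v, h⟩)

theorem lineMap_of_mem (l : Combinatorics.Line (D.Transversal R) ι) {v : D.V}
    (h : D.proj v ∈ s) : ∃ p, lineMap l v = .inl p ∧ p.1.1 = ⟨D.proj v, h⟩ ∧
      ∀ j, p.1.2 j = (l.idxFun j).elim v fun σ => σ.1 ⟨D.proj v, h⟩ :=
  ⟨_, dif_pos h, rfl, fun _ => rfl⟩

theorem lineMap_of_notMem (l : Combinatorics.Line (D.Transversal R) ι) {v : D.V}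
    (h : D.proj v ∉ s) : lineMap l v = .inr (l, ⟨v, h⟩) :=
  dif_neg h

theorem lineMap_eq_inr (l : Combinatorics.Line (D.Transversal R) ι) (v : {v // D.proj v ∉ s}) :
    lineMap l v.1 = .inr (l, v) :=
  lineMap_of_notMem l v.2

/-- The coordinate `j` of a tuple; it leaves the vertices of `D` outside of the tuples alone. -/
def coord (j : ι) : D.PowerVertex R ι → D.V :=
  Sum.elim (fun p => p.1.2 j) fun q => q.2.1

theorem coord_lineMap {l : Combinatorics.Line (D.Transversal R) ι} {j : ι}
    (hj : l.idxFun j = none) (v : D.V) : coord j (lineMap l v) = v := by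
  by_cases hv : D.proj v ∈ s
  · obtain ⟨p, hp, -, hpj⟩ := lineMap_of_mem l hv
    rw [hp]
    exact (hpj j).trans (by rw [hj, Option.elim_none])
  · rw [lineMap_of_notMem l hv]
    rfl

theorem lineMap_injective (l : Combinatorics.Line (D.Transversal R) ι) :
    Function.Injective (lineMap l) :=
  l.proper.elim fun _ hj => Function.LeftInverse.injective (coord_lineMap hj)

variable (D R ι)

/-- The labels of the power. Labels of tuples are computed coordinatewise, and pairs with a vertex
that belongs to a line `l` are labelled only if they are in the image of `lineMap l`. -/
noncomputable def powerLabel : D.PowerVertex R ι → D.PowerVertex R ι → Option T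
  | .inl p, .inl q => select (R p.1.1 q.1.1) fun j => D.label (p.1.2 j) (q.1.2 j)
  | .inl p, .inr (l, v) =>
    Function.extend (lineMap l) (D.label · v.1) (fun _ => none) (.inl p)
  | .inr (l, v), w => Function.extend (lineMap l) (D.label v.1) (fun _ => none) w

/-- The power of the parts of `D` over `s`, amalgamated freely with a copy of `D` over every
combinatorial line. -/
noncomputable def power [Finite s] [Finite ι] : PartiteSystem.{max u v y} N T where
  V := D.PowerVertex R ι
  finite := by
    have : Finite (D.Transversal R) := Subtype.finite
    have : Finite (Combinatorics.Line (D.Transversal R) ι) :=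
      Finite.of_injective (fun l => l.idxFun) fun l l' h => by
        cases l; cases l'; cases h; rfl
    infer_instance
  proj := Sum.elim (fun p => p.1.1) fun q => D.proj q.2.1
  label := D.powerLabel R ι

variable {D R ι}

theorem powerLabel_lineMap (l : Combinatorics.Line (D.Transversal R) ι) (v w : D.V) :
    D.powerLabel R ι (lineMap l v) (lineMap l w) = D.label v w := by
  by_cases hv : D.proj v ∈ s
  · obtain ⟨p, hp, hp₁, hp₂⟩ := lineMap_of_mem l hv
    by_cases hw : D.proj w ∈ s
    · obtain ⟨q, hq, hq₁, hq₂⟩ := lineMap_of_mem l hw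
      rw [hp, hq]
      refine select_eq (fun j => ?_) ?_
      · rw [hp₁, hq₁, hp₂, hq₂]
        cases l.idxFun j with
        | none => exact .inr rfl
        | some σ => exact .inl (σ.2.2 _ _)
      · obtain ⟨j, hj⟩ := l.proper
        exact ⟨j, by simp only [hp₂, hq₂, hj, Option.elim_none]⟩
    · rw [lineMap_of_notMem l hw, hp]
      simp only [powerLabel]
      rw [← hp, (lineMap_injective l).extend_apply]
  · rw [lineMap_of_notMem l hv]
    simp only [powerLabel]
    rw [(lineMap_injective l).extend_apply]

theorem isEmbedding_lineMap [Finite s] [Finite ι] (l : Combinatorics.Line (D.Transversal R) ι) :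
    D.IsEmbedding (D.power R ι) (lineMap l) where
  proj v := by
    by_cases hv : D.proj v ∈ s
    · obtain ⟨p, hp, hp₁, -⟩ := lineMap_of_mem l hv
      rw [hp]
      exact congrArg Subtype.val hp₁
    · rw [lineMap_of_notMem l hv]
      rfl
  label := powerLabel_lineMap l

theorem exists_lineMap_eq_of_powerLabel {l : Combinatorics.Line (D.Transversal R) ι}
    {v : {v // D.proj v ∉ s}} {w : D.PowerVertex R ι}
    (h : D.powerLabel R ι (.inr (l, v)) w ≠ none) : ∃ v', lineMap l v' = w := by
  by_contra hw
  exact h (Function.extend_apply' (D.label v.1) (fun _ => none) w hw)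

theorem powerLabel_cases {u w : D.PowerVertex R ι} (h : D.powerLabel R ι u w ≠ none) :
    (∃ p q, u = .inl p ∧ w = .inl q) ∨ ∃ l v v', u = lineMap l v ∧ w = lineMap l v' := by
  match u, w with
  | .inl p, .inl q => exact .inl ⟨p, q, rfl, rfl⟩
  | .inl p, .inr (l, v') =>
    obtain ⟨v, hv⟩ : ∃ v, lineMap l v = .inl p := by
      by_contra hp
      exact h (Function.extend_apply' (D.label · v'.1) (fun _ => none) _ hp)
    exact .inr ⟨l, v, v', hv.symm, (lineMap_eq_inr l v').symm⟩
  | .inr (l, v), w =>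
    obtain ⟨v', hv'⟩ := exists_lineMap_eq_of_powerLabel h
    exact .inr ⟨l, v, v', (lineMap_eq_inr l v).symm, hv'.symm⟩

theorem exists_lineMap_monochromatic (κ : Type x) [Finite κ] [Nonempty κ] [Finite s]
    (D : PartiteSystem.{u} N T) (R : s → s → Option T) :
    ∃ (ι : Type) (_ : Finite ι) (_ : Nonempty ι), ∀ χ : (s → D.PowerVertex R ι) → κ,
      ∃ l : Combinatorics.Line (D.Transversal R) ι, ∃ c,
        ∀ σ : D.Transversal R, χ (lineMap l ∘ σ.1) = c := by
  have : Finite (D.Transversal R) := Subtype.finite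
  obtain ⟨ι, _, hι⟩ := Combinatorics.Line.exists_mono_in_high_dimension (D.Transversal R) κ
  obtain ⟨l₀, -⟩ := hι fun _ => Classical.arbitrary κ
  refine ⟨ι, inferInstance, l₀.proper.nonempty, fun χ => ?_⟩
  obtain ⟨l, c, hc⟩ := hι fun τ => χ fun n => .inl ⟨(n, fun j => (τ j).1 n), fun j => (τ j).2.1 n⟩
  refine ⟨l, c, fun σ => ?_⟩
  rw [← hc σ]
  congr 1
  funext n
  have hn : D.proj (σ.1 n) ∈ s := σ.2.1 n ▸ n.2
  obtain ⟨p, hp, hp₁, hp₂⟩ := lineMap_of_mem l hn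
  have hpn : p.1.1 = n := hp₁.trans (Subtype.ext (σ.2.1 n))
  refine hp.trans (congrArg Sum.inl (Subtype.ext (Prod.ext hpn (funext fun j => ?_))))
  have hlσ : (l σ j).1 n = (l.idxFun j).elim (σ.1 n) fun τ => τ.1 n := by
    rw [Combinatorics.Line.coe_apply]
    cases l.idxFun j <;> rfl
  rw [hp₂, ← hp₁, hpn]
  exact hlσ.symm

end Power

section Covered

variable {D : PartiteSystem.{u} N T} {ρ : N → N → Option T} {F : Set (Set N)}

/-- The labels of `D` come from the labelling `ρ` of the set of parts, and the cliques of `D` are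
projected injectively into members of `F`. -/
structure IsCovered (D : PartiteSystem.{u} N T) (ρ : N → N → Option T) (F : Set (Set N)) :
    Prop where
  label_self : ∀ x, D.label x x ≠ none
  label_symm : ∀ x y, D.label x y ≠ none → D.label y x ≠ none
  label_eq : ∀ x y, D.label x y ≠ none → D.label x y = ρ (D.proj x) (D.proj y)
  eq_of_proj_eq : ∀ x y, D.label x y ≠ none → D.proj x = D.proj y → x = y
  exists_mapsTo : ∀ K : Set D.V, K.Nonempty → IsClique D.label K → ∃ t ∈ F, Set.MapsTo D.proj K t

variable {s : Set N} {R : s → s → Option T} {ι : Type y}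

theorem IsCovered.label_tuple (hD : D.IsCovered ρ F) (hR : ∀ m n, R m n = ρ m n)
    (p q : {p : s × (ι → D.V) // ∀ j, D.proj (p.2 j) = p.1}) {j : ι}
    (h : D.label (p.1.2 j) (q.1.2 j) ≠ none) : D.label (p.1.2 j) (q.1.2 j) = R p.1.1 q.1.1 := by
  rw [hD.label_eq _ _ h, p.2, q.2, hR]

theorem IsCovered.powerLabel_inl (hD : D.IsCovered ρ F) (hR : ∀ m n, R m n = ρ m n) [Nonempty ι]
    (p q : {p : s × (ι → D.V) // ∀ j, D.proj (p.2 j) = p.1}) :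
    D.powerLabel R ι (.inl p) (.inl q) ≠ none ↔ ∀ j, D.label (p.1.2 j) (q.1.2 j) ≠ none := by
  constructor
  · intro h j hj
    refine h (select_eq (fun i => ?_) ⟨j, hj⟩)
    exact (em _).symm.imp_left fun hi => hD.label_tuple hR p q hi
  · intro h
    obtain ⟨j⟩ := ‹Nonempty ι›
    have hselect : D.powerLabel R ι (.inl p) (.inl q) = D.label (p.1.2 j) (q.1.2 j) :=
      select_eq (fun i => .inl (hD.label_tuple hR p q (h i))) ⟨j, rfl⟩
    exact hselect ▸ h j

theorem IsCovered.powerLabel_eq (hD : D.IsCovered ρ F) (hR : ∀ m n, R m n = ρ m n) [Nonempty ι]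
    {p q : {p : s × (ι → D.V) // ∀ j, D.proj (p.2 j) = p.1}}
    (h : D.powerLabel R ι (.inl p) (.inl q) ≠ none) :
    D.powerLabel R ι (.inl p) (.inl q) = ρ p.1.1 q.1.1 := by
  obtain ⟨j⟩ := ‹Nonempty ι›
  have hj (i) := hD.label_tuple hR p q ((hD.powerLabel_inl hR p q).1 h i)
  exact (select_eq (fun i => .inl (hj i)) ⟨j, hj j⟩).trans (hR _ _)

theorem IsCovered.exists_isClique_coord (hD : D.IsCovered ρ F) (hR : ∀ m n, R m n = ρ m n)
    [Nonempty ι] {K : Set (D.PowerVertex R ι)} (hK : IsClique (D.powerLabel R ι) K) :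
    ∃ j, IsClique D.label (coord j '' K) := by
  by_cases hout : ∃ q, Sum.inr q ∈ K
  · obtain ⟨⟨l, v⟩, hv⟩ := hout
    obtain ⟨j, hj⟩ := l.proper
    refine ⟨j, ?_⟩
    rintro _ ⟨u, hu, rfl⟩ _ ⟨w, hw, rfl⟩
    obtain ⟨u, rfl⟩ := exists_lineMap_eq_of_powerLabel (hK _ hv u hu)
    obtain ⟨w, rfl⟩ := exists_lineMap_eq_of_powerLabel (hK _ hv w hw)
    rw [coord_lineMap hj, coord_lineMap hj, ← powerLabel_lineMap l]
    exact hK _ hu _ hw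
  · obtain ⟨j⟩ := ‹Nonempty ι›
    refine ⟨j, ?_⟩
    rintro _ ⟨p | q, hp, rfl⟩ _ ⟨p' | q', hp', rfl⟩
    · exact (hD.powerLabel_inl hR p p').1 (hK _ hp _ hp') j
    all_goals exact (hout ⟨_, by assumption⟩).elim

theorem IsCovered.power [Finite s] [Finite ι] [Nonempty ι] (hD : D.IsCovered ρ F)
    (hR : ∀ m n, R m n = ρ m n) : (D.power R ι).IsCovered ρ F where
  label_self
    | .inl p => (hD.powerLabel_inl hR p p).2 fun _ => hD.label_self _
    | .inr (l, v) => by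
      rw [← lineMap_eq_inr, (isEmbedding_lineMap l).label]
      exact hD.label_self _
  label_symm u w h := by
    obtain ⟨p, q, rfl, rfl⟩ | ⟨l, v, v', rfl, rfl⟩ := powerLabel_cases h
    · exact (hD.powerLabel_inl hR q p).2 fun j =>
        hD.label_symm _ _ ((hD.powerLabel_inl hR p q).1 h j)
    · rw [(isEmbedding_lineMap l).label] at h ⊢
      exact hD.label_symm _ _ h
  label_eq u w h := by
    obtain ⟨p, q, rfl, rfl⟩ | ⟨l, v, v', rfl, rfl⟩ := powerLabel_cases h
    · exact hD.powerLabel_eq hR h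
    · rw [(isEmbedding_lineMap l).label] at h ⊢
      rw [(isEmbedding_lineMap l).proj, (isEmbedding_lineMap l).proj]
      exact hD.label_eq _ _ h
  eq_of_proj_eq u w h huw := by
    obtain ⟨p, q, rfl, rfl⟩ | ⟨l, v, v', rfl, rfl⟩ := powerLabel_cases h
    · have hpq : p.1.1.1 = q.1.1.1 := huw
      refine congrArg Sum.inl (Subtype.ext (Prod.ext (Subtype.ext hpq) (funext fun j => ?_)))
      exact hD.eq_of_proj_eq _ _ ((hD.powerLabel_inl hR p q).1 h j) (by rw [p.2, q.2, hpq])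
    · rw [(isEmbedding_lineMap l).label] at h
      rw [(isEmbedding_lineMap l).proj, (isEmbedding_lineMap l).proj] at huw
      rw [hD.eq_of_proj_eq _ _ h huw]
  exists_mapsTo K hne hK := by
    obtain ⟨j, hj⟩ := hD.exists_isClique_coord hR hK
    obtain ⟨t, ht, hKt⟩ := hD.exists_mapsTo _ (hne.image _) hj
    have proj_coord : ∀ u : D.PowerVertex R ι, D.proj (coord j u) = (D.power R ι).proj u
      | .inl p => p.2 j
      | .inr _ => rfl
    exact ⟨t, ht, fun u hu => proj_coord u ▸ hKt ⟨u, hu, rfl⟩⟩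

end Covered

section Copies

variable {B : Type u} [Finite B] [Finite N]

open Classical in
/-- The disjoint union of copies of the labelled set `B`, one over every map in `S`. -/
noncomputable def copies (ρB : B → B → Option T) (S : Set (B → N)) :
    PartiteSystem.{max u v} N T where
  V := S × B
  finite := inferInstance
  proj p := p.1.1 p.2
  label p q := if p.1 = q.1 then ρB p.2 q.2 else none

variable {ρB : B → B → Option T} {S : Set (B → N)}

theorem copies_label_mk (b : S) (x y : B) : (copies ρB S).label (b, x) (b, y) = ρB x y :=
  if_pos rfl

theorem fst_eq_of_copies_label {p q : S × B} (h : (copies ρB S).label p q ≠ none) : p.1 = q.1 := by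
  by_contra hpq
  exact h (if_neg hpq)

theorem isCovered_copies {ρ : N → N → Option T} (hself : ∀ x, ρB x x ≠ none)
    (hsymm : ∀ x y, ρB x y ≠ none → ρB y x ≠ none) (hinj : ∀ b ∈ S, Function.Injective b)
    (hlabel : ∀ b ∈ S, PreservesLabels ρB ρ b) :
    (copies ρB S).IsCovered ρ (Set.range '' S) where
  label_self := fun ⟨b, x⟩ => by
    rw [copies_label_mk]
    exact hself x
  label_symm := fun ⟨b, x⟩ ⟨b', y⟩ h => by
    obtain rfl : b = b' := fst_eq_of_copies_label h
    rw [copies_label_mk] at h ⊢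
    exact hsymm x y h
  label_eq := fun ⟨b, x⟩ ⟨b', y⟩ h => by
    obtain rfl : b = b' := fst_eq_of_copies_label h
    rw [copies_label_mk]
    exact (hlabel b b.2 x y).symm
  eq_of_proj_eq := fun ⟨b, x⟩ ⟨b', y⟩ h hxy => by
    obtain rfl : b = b' := fst_eq_of_copies_label h
    exact congrArg (Prod.mk b) (hinj b b.2 hxy)
  exists_mapsTo := fun K ⟨⟨b, x⟩, hbx⟩ hK => by
    refine ⟨Set.range b.1, ⟨b.1, b.2, rfl⟩, fun ⟨b', y⟩ hby => ?_⟩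
    obtain rfl : b = b' := fst_eq_of_copies_label (hK _ hbx _ hby)
    exact ⟨y, rfl⟩

end Copies

section Arrow

variable {A : Type x} {ρA : A → A → Option T}

/-- The map `e` is a copy of the labelled set `A` in `D`, with `e x` in part `a x`. -/
def IsOver (D : PartiteSystem.{u} N T) (ρA : A → A → Option T) (a : A → N) (e : A → D.V) : Prop :=
  (∀ x, D.proj (e x) = a x) ∧ PreservesLabels ρA D.label e

theorem IsOver.comp {D : PartiteSystem.{u} N T} {D' : PartiteSystem.{u'} N T} {g : D.V → D'.V}
    (hg : D.IsEmbedding D' g) {a : A → N} {e : A → D.V} (he : D.IsOver ρA a e) :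
    D'.IsOver ρA a (g ∘ e) :=
  ⟨fun x => (hg.proj _).trans (he.1 x), fun x y => (hg.label _ _).trans (he.2 x y)⟩

/-- The labels of the range of `a` that make `a` an isomorphism of labelled sets. -/
noncomputable def rangeLabel (ρA : A → A → Option T) {a : A → N} (ha : Function.Injective a) :
    Set.range a → Set.range a → Option T :=
  fun m n => ρA ((Equiv.ofInjective a ha).symm m) ((Equiv.ofInjective a ha).symm n)

theorem rangeLabel_eq {ρ : N → N → Option T} {a : A → N} (ha : Function.Injective a)
    (hlabel : PreservesLabels ρA ρ a) (m n : Set.range a) : rangeLabel ρA ha m n = ρ m n := by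
  rw [rangeLabel, ← hlabel, Equiv.apply_ofInjective_symm ha, Equiv.apply_ofInjective_symm ha]

variable [Finite A]

theorem exists_power_monochromatic (κ : Type y) [Finite κ] [Nonempty κ]
    (D : PartiteSystem.{u} N T) (ρA : A → A → Option T) {a : A → N} (ha : Function.Injective a) :
    ∃ (ι : Type) (_ : Finite ι) (_ : Nonempty ι),
      ∀ χ : (A → (D.power (rangeLabel ρA ha) ι).V) → κ,
        ∃ f, D.IsEmbedding (D.power (rangeLabel ρA ha) ι) f ∧
          ∃ c, ∀ e, D.IsOver ρA a e → χ (f ∘ e) = c := by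
  let i : A ≃ Set.range a := Equiv.ofInjective a ha
  obtain ⟨ι, _, _, hι⟩ := exists_lineMap_monochromatic κ D (rangeLabel ρA ha)
  refine ⟨ι, inferInstance, inferInstance, fun χ => ?_⟩
  obtain ⟨l, c, hc⟩ := hι fun g => χ (g ∘ i)
  refine ⟨lineMap l, isEmbedding_lineMap l, c, fun e he => ?_⟩
  have hproj (n : Set.range a) : D.proj (e (i.symm n)) = n :=
    (he.1 _).trans (Equiv.apply_ofInjective_symm ha n)
  rw [← hc ⟨e ∘ i.symm, hproj, fun m n => he.2 _ _⟩]
  exact congrArg χ (funext fun x => congrArg (lineMap l ∘ e) (i.symm_apply_apply x).symm)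

theorem exists_iterated_power (κ : Type y) [Finite κ] [Nonempty κ] (ρA : A → A → Option T)
    (Inv : PartiteSystem.{max u v} N T → Prop) {P : PartiteSystem.{max u v} N T} (hP : Inv P)
    {S : Set (A → N)} (hS : S.Finite) (hinj : ∀ a ∈ S, Function.Injective a)
    (hpower : ∀ a (ha : a ∈ S) D, Inv D → ∀ (ι : Type) [Finite ι] [Nonempty ι],
      Inv (D.power (rangeLabel ρA (hinj a ha)) ι)) :
    ∃ D, Inv D ∧ ∀ χ : (A → D.V) → κ, ∃ f, P.IsEmbedding D f ∧
      ∀ a ∈ S, ∃ c, ∀ e, P.IsOver ρA a e → χ (f ∘ e) = c := by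
  induction S, hS using Set.Finite.induction_on with
  | empty => exact ⟨P, hP, fun χ => ⟨id, .id P, fun a ha => ha.elim⟩⟩
  | @insert a S _ _ ih =>
    obtain ⟨D, hD, harrow⟩ := ih (fun a' ha' => hinj a' (.inr ha'))
      fun a' ha' => hpower a' (.inr ha')
    obtain ⟨ι, _, _, hι⟩ := exists_power_monochromatic κ D ρA (hinj a (.inl rfl))
    refine ⟨D.power _ ι, hpower a (.inl rfl) D hD ι, fun χ => ?_⟩
    obtain ⟨g, hg, c, hc⟩ := hι χ
    obtain ⟨f, hf, hfS⟩ := harrow fun e => χ (g ∘ e)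
    refine ⟨g ∘ f, hg.comp hf, ?_⟩
    rintro a' (rfl | ha')
    · exact ⟨c, fun e he => hc (f ∘ e) (he.comp hf)⟩
    · exact hfS a' ha'

/-- A colouring of the copies of `A` in the system that is constant over every place `b ∘ e` induces
a colouring of the places, to which the arrow in `N` applies. -/
theorem exists_mapArrow_partite {κ : Type y} [Finite κ] [Nonempty κ] {B : Type u} [Finite B]
    [Finite N] {ρB : B → B → Option T} {E : Set (A → B)} (hE : ∀ e ∈ E, PreservesLabels ρA ρB e)
    {S : Set (B → N)} (harrow : MapArrow κ E S)
    (hinj : ∀ a ∈ Set.image2 (· ∘ ·) S E, Function.Injective a)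
    (Inv : PartiteSystem.{max u v} N T → Prop) (hcopies : Inv (copies ρB S))
    (hpower : ∀ a (ha : a ∈ Set.image2 (· ∘ ·) S E) D, Inv D →
      ∀ (ι : Type) [Finite ι] [Nonempty ι], Inv (D.power (rangeLabel ρA (hinj a ha)) ι)) :
    ∃ D, Inv D ∧ MapArrow κ E {f | PreservesLabels ρB D.label f ∧ D.proj ∘ f ∈ S} := by
  obtain ⟨D, hD, hχ⟩ := exists_iterated_power κ ρA Inv hcopies (Set.toFinite _) hinj hpower
  refine ⟨D, hD, fun χ => ?_⟩
  obtain ⟨f, hf, hmono⟩ := hχ χ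
  choose! colour hcolour using hmono
  obtain ⟨b, hb, c, hc⟩ := harrow colour
  have hproj : D.proj ∘ f ∘ Prod.mk ⟨b, hb⟩ = b := funext fun x => hf.proj _
  refine ⟨f ∘ Prod.mk ⟨b, hb⟩, ⟨fun x y => ?_, hproj.symm ▸ hb⟩, c, fun e he => ?_⟩
  · exact (hf.label _ _).trans (copies_label_mk _ x y)
  · rw [← hc e he]
    refine hcolour _ ⟨b, hb, e, he, rfl⟩ (Prod.mk ⟨b, hb⟩ ∘ e) ⟨fun _ => rfl, fun x y => ?_⟩
    exact (copies_label_mk _ _ _).trans (hE e he x y)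

end Arrow

end PartiteSystem

section OrderedArrow

universe u v w x y

theorem exists_linearOrder_monotone {V : Type u} {N : Type v} [LinearOrder N] (h : V → N) :
    ∃ _ : LinearOrder V, Monotone h := by
  classical
  let := linearOrderOfSTO (WellOrderingRel (α := V))
  let key : V → N ×ₗ V := fun v => toLex (h v, v)
  have hkey : Function.Injective key := fun v w hvw => congrArg (fun p => (ofLex p).2) hvw
  exact ⟨LinearOrder.lift' key hkey, fun v w hvw => Prod.Lex.monotone_fst _ _ hvw⟩

theorem strictMono_toLex {B : Type u} {P : Type v} {N : Type w} [Preorder B] [PartialOrder P]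
    [PartialOrder N] {p : B → P} {b : B → N} (hp : Monotone p) (hb : StrictMono b) :
    StrictMono fun x => toLex (p x, b x) := fun _ _ hxy =>
  Prod.Lex.toLex_lt_toLex'.2 ⟨hp hxy.le, fun _ => hb hxy⟩

variable {A : Type x} {B : Type u} {T : Type w} [LinearOrder A] [LinearOrder B]

/-- All cliques of the ordered labelled set `V` embed in `B`. This is what the free amalgamation of
copies of `B` provides; it ensures that every complete structure that `B` avoids is avoided by `V`
as well. -/
structure LocallyEmbeds {V : Type v} [Preorder V] (ρ : V → V → Option T) (ρB : B → B → Option T) :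
    Prop where
  label_self : ∀ x, ρ x x ≠ none
  label_symm : ∀ x y, ρ x y ≠ none → ρ y x ≠ none
  exists_embedding : ∀ K : Set V, K.Nonempty → IsClique ρ K →
    ∃ g : V → B, StrictMonoOn g K ∧ ∀ x ∈ K, ∀ y ∈ K, ρB (g x) (g y) = ρ x y

theorem PartiteSystem.IsCovered.locallyEmbeds {N : Type v} {P : Type y} [LinearOrder N]
    [LinearOrder P] {ρ : N → N → Option T} {ρB : B → B → Option T} {D : PartiteSystem.{u} N T}
    [PartialOrder D.V] (hD : D.IsCovered ρ (Set.range '' labelledEmbeddings ρB ρ))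
    {p : Option T → P} (hp : Monotone fun x => p (ρB x x))
    (hproj : Monotone fun v => toLex (p (D.label v v), D.proj v)) : LocallyEmbeds D.label ρB where
  label_self := hD.label_self
  label_symm := hD.label_symm
  exists_embedding K hne hK := by
    obtain ⟨_, ⟨b, hb, rfl⟩, hKb⟩ := hD.exists_mapsTo K hne hK
    have : Nonempty B := let ⟨v, hv⟩ := hne; let ⟨x, _⟩ := hKb hv; ⟨x⟩
    choose! g hg using fun v (hv : v ∈ K) => hKb hv
    have hlabel : ∀ x ∈ K, ∀ y ∈ K, ρB (g x) (g y) = D.label x y := fun x hx y hy => by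
      rw [hD.label_eq x y (hK x hx y hy), ← hg x hx, ← hg y hy, hb.2]
    refine ⟨g, fun x hx y hy hxy => (strictMono_toLex hp hb.1).lt_iff_lt.1 ?_, hlabel⟩
    simp only [hlabel x hx x hx, hlabel y hy y hy, hg x hx, hg y hy]
    refine (hproj hxy.le).lt_of_ne fun h => hxy.ne ?_
    exact hD.eq_of_proj_eq x y (hK x hx y hy) (congrArg (fun q => (ofLex q).2) h)

variable [Finite A] [Finite B]

theorem exists_mapArrow_labelledEmbeddings (κ : Type v) [Finite κ] [Nonempty κ]
    (ρA : A → A → Option T) (ρB : B → B → Option T) :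
    ∃ (N : Type u) (_ : Finite N) (_ : LinearOrder N) (ρ : N → N → Option T),
      MapArrow κ (labelledEmbeddings ρA ρB) (labelledEmbeddings ρB ρ) := by
  obtain ⟨n, hn⟩ := exists_mapArrow_strictMono κ A B
  obtain ⟨D, -, hD⟩ := PartiteSystem.exists_mapArrow_partite (ρA := ρA) (ρB := ρB)
    (E := labelledEmbeddings ρA ρB) (fun e he => he.2) (hn.mono (fun e he => he.1) subset_rfl)
    (by rintro _ ⟨b, hb, e, he, rfl⟩; exact (hb.comp he.1).injective) (fun _ => True) trivial
    fun _ _ _ _ _ _ _ => trivial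
  obtain ⟨_, hproj⟩ := exists_linearOrder_monotone D.proj
  refine ⟨D.V, D.finite, inferInstance, D.label, hD.mono subset_rfl fun f hf => ⟨?_, hf.1⟩⟩
  exact fun x y hxy => hproj.reflect_lt (hf.2 hxy)

/-- Two rounds of the partite construction: the first one makes the labels of `B` available, and the
second one makes the amalgamation free. -/
theorem exists_mapArrow_locallyEmbeds {P : Type y} [LinearOrder P] (κ : Type v) [Finite κ]
    [Nonempty κ] (ρA : A → A → Option T) {ρB : B → B → Option T} (hself : ∀ x, ρB x x ≠ none)
    (hsymm : ∀ x y, ρB x y ≠ none → ρB y x ≠ none) {p : Option T → P}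
    (hp : Monotone fun x => p (ρB x x)) :
    ∃ (V : Type u) (_ : Finite V) (_ : LinearOrder V) (ρ : V → V → Option T),
      LocallyEmbeds ρ ρB ∧ (Monotone fun v => p (ρ v v)) ∧
        MapArrow κ (labelledEmbeddings ρA ρB) (labelledEmbeddings ρB ρ) := by
  obtain ⟨N, _, _, ρ, hN⟩ := exists_mapArrow_labelledEmbeddings κ ρA ρB
  obtain ⟨D, hcov, hD⟩ := PartiteSystem.exists_mapArrow_partite (fun e he => he.2) hN
    (by rintro _ ⟨b, hb, e, he, rfl⟩; exact (hb.1.comp he.1).injective)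
    (fun D => D.IsCovered ρ (Set.range '' labelledEmbeddings ρB ρ))
    (PartiteSystem.isCovered_copies hself hsymm (fun b hb => hb.1.injective) fun b hb => hb.2) (by
      rintro _ ⟨b, hb, e, he, rfl⟩ D hD ι _ _
      exact hD.power (PartiteSystem.rangeLabel_eq _ fun x y => (hb.2 _ _).trans (he.2 x y)))
  obtain ⟨_, hproj⟩ := exists_linearOrder_monotone fun v => toLex (p (D.label v v), D.proj v)
  refine ⟨D.V, D.finite, inferInstance, D.label, hcov.locallyEmbeds hp hproj,
    fun v w hvw => Prod.Lex.monotone_fst _ _ (hproj hvw),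
    hD.mono subset_rfl fun f hf => ⟨fun x y hxy => hproj.reflect_lt ?_, hf.1⟩⟩
  simp only [hf.1 _ _]
  exact strictMono_toLex hp hf.2.1 hxy

end OrderedArrow

section Translation

variable {A B C F : RedStr}

/-- The vertex `x` is in the unary relation `r`. -/
def UnRel (A : RedStr) (r : RedRel 1) (x : A) : Prop :=
  Language.Structure.RelMap (L := redLang) (n := 1) r ![x]

theorem relMap_one_iff (r : RedRel 1) (x : Fin 1 → A) :
    Language.Structure.RelMap (L := redLang) (n := 1) r x ↔ UnRel A r (x 0) :=
  iff_of_eq (congrArg _ (FinVec.etaExpand_eq x).symm)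

theorem relMap_two_iff (r : RedRel 2) (x : Fin 2 → A) :
    Language.Structure.RelMap (L := redLang) (n := 2) r x ↔ BinRel A r (x 0) (x 1) :=
  iff_of_eq (congrArg _ (FinVec.etaExpand_eq x).symm)

theorem unRel_embedding (f : A ↪[redLang] C) (r : RedRel 1) (x : A) :
    UnRel C r (f x) ↔ UnRel A r x :=
  (relMap_one_iff r (f ∘ ![x])).symm.trans (f.map_rel (n := 1) r ![x])

theorem binRel_embedding (f : A ↪[redLang] C) (r : RedRel 2) (x y : A) :
    BinRel C r (f x) (f y) ↔ BinRel A r x y :=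
  (relMap_two_iff r (f ∘ ![x, y])).symm.trans (f.map_rel (n := 2) r ![x, y])

/-- The embedding of `L•`-structures given by an injection that preserves and reflects the unary and
the binary relations. -/
def embeddingOfRel (f : A → C) (hf : Function.Injective f)
    (h₁ : ∀ r x, UnRel C r (f x) ↔ UnRel A r x)
    (h₂ : ∀ r x y, BinRel C r (f x) (f y) ↔ BinRel A r x y) : A ↪[redLang] C where
  toFun := f
  inj' := hf
  map_fun' := fun F => Empty.elim F
  map_rel' {n} r x := match n, r with
    | 1, r => (relMap_one_iff r _).trans ((h₁ r _).trans (relMap_one_iff r x).symm)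
    | 2, r => (relMap_two_iff r _).trans ((h₂ r _ _).trans (relMap_two_iff r x).symm)

/-- The label of a pair of vertices: the unary relations of the first vertex and the binary
relations of the pair, except for the order. -/
abbrev PairLabel : Type := Set (RedRel 1) × Set (RedRel 2)

/-- The unary relations recorded by an optional label. -/
def unaryRels (o : Option PairLabel) : Set (RedRel 1) := o.elim ∅ Prod.fst

/-- The binary relations recorded by an optional label. -/
def binaryRels (o : Option PairLabel) : Set (RedRel 2) := o.elim ∅ Prod.snd

open Classical in
/-- The label of `(x, y)`, or `none` if `x` and `y` are distinct and in no common relation other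
than the order, so that the complete structures are those in which all pairs have a label. -/
noncomputable def pairLabel (A : RedStr) (x y : A) : Option PairLabel :=
  if x = y ∨ ∃ r, r ≠ .le ∧ (BinRel A r x y ∨ BinRel A r y x) then
    some ({r | UnRel A r x}, {r | r ≠ .le ∧ BinRel A r x y}) else none

theorem pairLabel_ne_none_iff {x y : A} :
    pairLabel A x y ≠ none ↔ x = y ∨ ∃ r, r ≠ .le ∧ (BinRel A r x y ∨ BinRel A r y x) := by
  rw [pairLabel]
  split_ifs with h <;> simp [h]

theorem pairLabel_self_ne_none (x : A) : pairLabel A x x ≠ none :=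
  pairLabel_ne_none_iff.2 (.inl rfl)

theorem pairLabel_ne_none_symm (x y : A) (h : pairLabel A x y ≠ none) :
    pairLabel A y x ≠ none := by
  simpa only [pairLabel_ne_none_iff, eq_comm, or_comm] using h

theorem mem_unaryRels_pairLabel_self {x : A} {r : RedRel 1} :
    r ∈ unaryRels (pairLabel A x x) ↔ UnRel A r x := by
  simp [pairLabel, unaryRels]

theorem mem_binaryRels_pairLabel {x y : A} {r : RedRel 2} (hr : r ≠ .le) :
    r ∈ binaryRels (pairLabel A x y) ↔ BinRel A r x y := by
  rw [pairLabel]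
  split_ifs with h
  · simp [binaryRels, hr]
  · exact iff_of_false (Set.notMem_empty r) fun hxy => h (.inr ⟨r, hr, .inl hxy⟩)

theorem pairLabel_congr {x y : A} {x' y' : C} (heq : x = y ↔ x' = y')
    (h₁ : ∀ r, UnRel A r x ↔ UnRel C r x')
    (h₂ : ∀ r ≠ .le, BinRel A r x y ↔ BinRel C r x' y')
    (h₂' : ∀ r ≠ .le, BinRel A r y x ↔ BinRel C r y' x') :
    pairLabel A x y = pairLabel C x' y' := by
  have hset : {r | r ≠ .le ∧ BinRel A r x y} = {r | r ≠ .le ∧ BinRel C r x' y'} :=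
    Set.ext fun r => and_congr_right (h₂ r)
  simp only [pairLabel, h₁, hset]
  classical exact if_congr (or_congr heq (exists_congr fun r => and_congr_right fun hr =>
    or_congr (h₂ r hr) (h₂' r hr))) rfl rfl

/-- The order of the type `A` is the relation `≤` of the structure `A`. -/
def OrderedBy (A : RedStr) [LE A] : Prop :=
  ∀ x y : A, BinRel A .le x y ↔ x ≤ y

/-- The linear order of an ordered structure. -/
@[reducible]
noncomputable def IsOrdered.linearOrder (h : IsOrdered A) : LinearOrder A where
  le := BinRel A .le
  le_refl := h.refl
  le_trans := h.trans
  le_antisymm := h.antisymm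
  le_total := h.total
  toDecidableLE := Classical.decRel _

theorem OrderedBy.isOrdered [LinearOrder A] (h : OrderedBy A) : IsOrdered A where
  refl x := (h x x).2 le_rfl
  antisymm x y hxy hyx := ((h x y).1 hxy).antisymm ((h y x).1 hyx)
  trans x y z hxy hyz := (h x z).2 (((h x y).1 hxy).trans ((h y z).1 hyz))
  total x y := by simpa only [h _ _] using le_total x y

theorem OrderedBy.before_iff [PartialOrder A] (h : OrderedBy A) {x y : A} :
    Before A x y ↔ x < y := by
  rw [Before, h, lt_iff_le_and_ne]

theorem range_coe_embedding [LinearOrder A] [LinearOrder C] (hA : OrderedBy A)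
    (hC : OrderedBy C) : Set.range (DFunLike.coe : (A ↪[redLang] C) → A → C) =
      labelledEmbeddings (pairLabel A) (pairLabel C) := by
  ext f
  constructor
  · rintro ⟨f, rfl⟩
    refine ⟨fun x y hxy => ?_, fun x y => pairLabel_congr f.injective.eq_iff
      (fun r => unRel_embedding f r x) (fun r _ => binRel_embedding f r x y)
      fun r _ => binRel_embedding f r y x⟩
    refine lt_of_le_of_ne ?_ (f.injective.ne hxy.ne)
    rw [← hC, binRel_embedding, hA]
    exact hxy.le
  · rintro ⟨hmono, hlabel⟩
    refine ⟨embeddingOfRel f hmono.injective (fun r x => ?_) fun r x y => ?_, rfl⟩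
    · rw [← mem_unaryRels_pairLabel_self, hlabel, mem_unaryRels_pairLabel_self]
    · rcases eq_or_ne r .le with rfl | hr
      · rw [hC, hmono.le_iff_le, hA]
      · rw [← mem_binaryRels_pairLabel hr, hlabel, mem_binaryRels_pairLabel hr]

/-- The `L•`-structure on `V` with the given labels of pairs and with the order of `V`. -/
abbrev ofLabels {V : Type} [LE V] (ρ : V → V → Option PairLabel) : RedStr where
  α := V
  str :=
    { funMap := fun f => Empty.elim f
      RelMap := fun {n} r x => match n, r with
        | 1, r => r ∈ unaryRels (ρ (x 0) (x 0))
        | 2, .le => x 0 ≤ x 1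
        | 2, r => r ∈ binaryRels (ρ (x 0) (x 1)) }

theorem binRel_ofLabels {V : Type} [LE V] {ρ : V → V → Option PairLabel} {r : RedRel 2}
    (hr : r ≠ .le) (v w : V) : BinRel (ofLabels ρ) r v w ↔ r ∈ binaryRels (ρ v w) := by
  cases r with
  | le => exact absurd rfl hr
  | _ => exact Iff.rfl

theorem pairLabel_ofLabels {V : Type} [LinearOrder V] [LinearOrder B]
    {ρ : V → V → Option PairLabel} (hρ : LocallyEmbeds ρ (pairLabel B)) :
    pairLabel (ofLabels ρ) = ρ := by
  ext1 v; ext1 w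
  by_cases hvw : ρ v w = none
  · have hwv : ρ w v = none := by_contra fun h => hρ.label_symm w v h hvw
    rw [hvw, ← not_ne_iff, pairLabel_ne_none_iff]
    rintro (rfl | ⟨r, hr, h⟩)
    · exact hρ.label_self _ hvw
    · simp only [binRel_ofLabels hr, hvw, hwv] at h
      exact h.elim id id
  · obtain ⟨g, hmono, hlabel⟩ := hρ.exists_embedding {v, w} ⟨v, .inl rfl⟩ (by
      rintro _ (rfl | rfl) _ (rfl | rfl)
      exacts [hρ.label_self _, hvw, hρ.label_symm _ _ hvw, hρ.label_self _])
    have hv : v ∈ ({v, w} : Set V) := .inl rfl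
    have hw : w ∈ ({v, w} : Set V) := .inr rfl
    rw [← hlabel v hv w hw]
    refine pairLabel_congr (hmono.injOn.eq_iff hv hw).symm (fun r => ?_) (fun r hr => ?_)
      fun r hr => ?_
    · rw [← mem_unaryRels_pairLabel_self (A := B), hlabel v hv v hv]
      rfl
    · rw [← mem_binaryRels_pairLabel (A := B) hr, hlabel v hv w hw, binRel_ofLabels hr]
    · rw [← mem_binaryRels_pairLabel (A := B) hr, hlabel w hw v hv, binRel_ofLabels hr]

open Classical in
/-- The position of a vertex in an admissible order, computed from its label: vertices in `L` are in
block `0`, those in `1` are in block `1`, and all others are in block `2`. -/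
noncomputable def block (o : Option PairLabel) : ℕ :=
  if .left ∈ unaryRels o then 0 else if .first ∈ unaryRels o then 1 else 2

theorem block_pairLabel_self_eq (x : A) [Decidable (InLeft A x)] [Decidable (InFirst A x)] :
    block (pairLabel A x x) = if InLeft A x then 0 else if InFirst A x then 1 else 2 := by
  have hunary (r : RedRel 1) : r ∈ unaryRels (pairLabel A x x) ↔ UnRel A r x :=
    mem_unaryRels_pairLabel_self
  classical exact if_congr (hunary .left) rfl (if_congr (hunary .first) rfl rfl)

theorem isAdmissiblyOrdered_iff [LinearOrder A] (hA : OrderedBy A) :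
    IsAdmissiblyOrdered A ↔
      (∀ x, InLeft A x → ¬ InFirst A x) ∧ Monotone fun x => block (pairLabel A x x) := by
  classical
  simp only [block_pairLabel_self_eq]
  constructor
  · rintro ⟨-, hleft_first, hleft_rest, hfirst_rest⟩
    simp only [hA.before_iff] at hleft_first hleft_rest hfirst_rest
    refine ⟨fun x hl hf => (hleft_first x x hl hf).false, fun x y hxy => ?_⟩
    have h₁ := hleft_first y x
    have h₂ := hleft_rest y x
    have h₃ := hfirst_rest y x
    simp only [hxy.not_gt] at h₁ h₂ h₃
    dsimp only
    split_ifs <;> first | omega | tauto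
  · rintro ⟨hdisj, hmono⟩
    refine ⟨hA.isOrdered, fun x y hx hy => ?_, fun x y hx hy hy' => ?_, fun x y hx hy hy' => ?_⟩ <;>
      refine hA.before_iff.2 (hmono.reflect_lt ?_)
    · simp [hx, hy, show ¬ InLeft A y from fun h => hdisj y h hy]
    · simp [hx, hy, hy']
    · simp [hx, hy, hy', show ¬ InLeft A x from fun h => hdisj x h hx]

theorem LocallyEmbeds.isAdmissiblyOrdered [LinearOrder B] [LinearOrder C] (hB : OrderedBy B)
    (hC : OrderedBy C) (hCB : LocallyEmbeds (pairLabel C) (pairLabel B))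
    (hblock : Monotone fun v => block (pairLabel C v v)) (h : IsAdmissiblyOrdered B) :
    IsAdmissiblyOrdered C := by
  refine (isAdmissiblyOrdered_iff hC).2 ⟨fun v hl hf => ?_, hblock⟩
  obtain ⟨g, -, hg⟩ := hCB.exists_embedding {v} ⟨v, rfl⟩ (by
    rintro _ rfl _ rfl
    exact pairLabel_self_ne_none _)
  have hunary (r : RedRel 1) : UnRel B r (g v) ↔ UnRel C r v := by
    rw [← mem_unaryRels_pairLabel_self, hg v rfl v rfl, mem_unaryRels_pairLabel_self]
  exact ((isAdmissiblyOrdered_iff hB).1 h).1 (g v) ((hunary _).2 hl) ((hunary _).2 hf)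

theorem IsComplete.isClique_range (hF : IsComplete F) (φ : F ↪[redLang] C) :
    IsClique (pairLabel C) (Set.range φ) := by
  rintro _ ⟨x, rfl⟩ _ ⟨y, rfl⟩
  rw [pairLabel_ne_none_iff, φ.injective.eq_iff]
  simp only [binRel_embedding]
  exact or_iff_not_imp_left.2 (hF x y)

theorem LocallyEmbeds.nonempty_embedding [LinearOrder B] [LinearOrder C] (hB : OrderedBy B)
    (hC : OrderedBy C) (hCB : LocallyEmbeds (pairLabel C) (pairLabel B)) (hF : IsComplete F)
    (φ : F ↪[redLang] C) : Nonempty (F ↪[redLang] B) := by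
  rcases isEmpty_or_nonempty F with _ | _
  · exact ⟨embeddingOfRel isEmptyElim (fun x => isEmptyElim x) (fun _ x => isEmptyElim x)
      fun _ x => isEmptyElim x⟩
  let _ : LinearOrder F := .lift' φ φ.injective
  have hord : OrderedBy F := fun x y => (binRel_embedding φ .le x y).symm.trans (hC _ _)
  obtain ⟨g, hmono, hg⟩ := hCB.exists_embedding _ (Set.range_nonempty φ) (hF.isClique_range φ)
  have hφ : ⇑φ ∈ labelledEmbeddings (pairLabel F) (pairLabel C) :=
    range_coe_embedding hord hC ▸ Set.mem_range_self φ
  have hgφ : g ∘ φ ∈ labelledEmbeddings (pairLabel F) (pairLabel B) :=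
    ⟨fun x y hxy => hmono ⟨x, rfl⟩ ⟨y, rfl⟩ (hφ.1 hxy),
      fun x y => (hg _ ⟨x, rfl⟩ _ ⟨y, rfl⟩).trans (hφ.2 x y)⟩
  rw [← range_coe_embedding hord hB] at hgφ
  exact let ⟨ψ, _⟩ := hgφ; ⟨ψ⟩

theorem LocallyEmbeds.mem_forb {S : Set RedStr} (hS : ∀ F ∈ S, IsComplete F) [Finite C]
    [LinearOrder B] [LinearOrder C] (hB : OrderedBy B) (hC : OrderedBy C)
    (hCB : LocallyEmbeds (pairLabel C) (pairLabel B))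
    (hblock : Monotone fun v => block (pairLabel C v v)) (h : B ∈ forb S) : C ∈ forb S :=
  ⟨‹_›, hCB.isAdmissiblyOrdered hB hC hblock h.2.1, fun F hF =>
    ⟨fun φ => let ⟨ψ⟩ := hCB.nonempty_embedding hB hC (hS F hF) φ; (h.2.2 F hF).false ψ⟩⟩

theorem arrows_of_mapArrow {k : ℕ} [NeZero k]
    (h : MapArrow (Fin k) (Set.range (DFunLike.coe : (A ↪[redLang] B) → A → B))
      (Set.range (DFunLike.coe : (B ↪[redLang] C) → B → C))) : Arrows C B A k := by
  intro χ
  let χ' (e : A ↪[redLang] C) : Fin k := χ ⟨e.toHom.range, ⟨e.equivRange⟩⟩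
  obtain ⟨_, ⟨f, rfl⟩, c, hc⟩ := h (Function.extend DFunLike.coe χ' 0)
  refine ⟨f.toHom.range, ⟨f.equivRange⟩, c, fun ⟨A', ⟨g⟩⟩ hA' => ?_⟩
  let e : A ↪[redLang] B :=
    f.equivRange.symm.toEmbedding.comp ((Language.Substructure.inclusion hA').comp g.toEmbedding)
  have hfe (x : A) : f (e x) = g x :=
    congrArg Subtype.val (f.equivRange.apply_symm_apply (Language.Substructure.inclusion hA' (g x)))
  have hrange : (f.comp e).toHom.range = A' := by
    ext z
    refine ⟨?_, fun hz => ?_⟩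
    · rintro ⟨x, rfl⟩
      exact (hfe x).symm ▸ (g x).2
    · obtain ⟨x, hx⟩ := g.surjective ⟨z, hz⟩
      exact ⟨x, (hfe x).trans (congrArg Subtype.val hx)⟩
  have hχ := hc e ⟨e, rfl⟩
  rw [show f ∘ e = ⇑(f.comp e) from rfl, DFunLike.coe_injective.extend_apply] at hχ
  exact (congrArg χ (Subtype.ext hrange.symm)).trans hχ

end Translation

end BowtieFree

open BowtieFree in
theorem mainTheorem5_general {S : Set RedStr} (hS : ∀ F ∈ S, IsComplete F) :
    IsRamseyClass (forb S) := by
  intro A hA B hB k hk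
  have : NeZero k := ⟨Nat.one_le_iff_ne_zero.1 hk⟩
  have : Finite A := hA.1
  have : Finite B := hB.1
  let _ := hA.2.1.ordered.linearOrder
  let _ := hB.2.1.ordered.linearOrder
  have hordA : OrderedBy A := fun _ _ => Iff.rfl
  have hordB : OrderedBy B := fun _ _ => Iff.rfl
  obtain ⟨V, _, _, ρ, hρ, hblock, harrow⟩ := exists_mapArrow_locallyEmbeds (Fin k) (pairLabel A)
    pairLabel_self_ne_none pairLabel_ne_none_symm ((isAdmissiblyOrdered_iff hordB).1 hB.2.1).2
  have hordC : OrderedBy (ofLabels ρ) := fun _ _ => Iff.rfl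
  have hlabel : pairLabel (ofLabels ρ) = ρ := pairLabel_ofLabels hρ
  refine ⟨ofLabels ρ, LocallyEmbeds.mem_forb hS hordB hordC ?_ ?_ hB, arrows_of_mapArrow ?_⟩
  · rwa [hlabel]
  · rwa [hlabel]
  · rwa [range_coe_embedding hordA hordB, range_coe_embedding hordB hordC, hlabel]

theorem mainTheorem5 :
    BowtieFree.IsRamseyClass (BowtieFree.forb BowtieFree.triangles) :=
  mainTheorem5_general fun _ hF => hF.2.2.1
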